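/- Let $k$ be a field and let $D$ be a finite-dimensional division algebra over $k$ (a division ring that is a $k$-algebra of finite dimension). Let $D^*=\mathrm{Hom}_k(D,k)$ be the dual coalgebra, with $\Delta(f)=\sum f_1\otimes f_2$ determined by $f(ab)=\sum f_1(a)f_2(b)$ for all $a,b\in D$, and $\varepsilon(f)=f(1)$; regard $D^*$ as a $D^*$-bicomodule by the dual of the regular $D$-bimodule $D$. For a coalgebra $C$ and a $C$-bicomodule $M$ with coactions $\rho^l,\rho^r$, the cotensor coalgebra is $T_C(M)=\bigoplus_{n\ge 0}M^{\Box_C n}$, where $M^{\Box_C 0}=C$ and $M^{\Box_C n}=M\,\Box_C\cdots\Box_C\,M$ ($n$ factors). Its comultiplication is $\Delta_C$ on $C$, $\rho^l+\rho^r$ on $M$, and for $n\ge 2$ $$\Delta(m_1\Box\cdots\Box m_n)=\sum (m_1)_{-1}\otimes((m_1)_0\Box m_2\Box\cdots\Box m_n)+\sum_{i=1}^{n-1}(m_1\Box\cdots\Box m_i)\otimes(m_{i+1}\Box\cdots\Box m_n)+\sum (m_1\Box\cdots\Box m_{n-1}\Box (m_n)_0)\otimes (m_n)_1 ;$$ its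 counit is $\varepsilon_C$ on $C$ and $0$ on $M^{\Box_C n}$ for $n\ge1$. Put $\mathcal{DC}(D,\mathrm{id})=T_{D^*}(D^*)$. Let $D[[x]]$ be the ring of formal power series over $D$ in a central variable $x$. Let $D[[x]]^\circ$ be its finite dual: the coalgebra of all $k$-linear functionals $f:D[[x]]\to k$ that vanish on some two-sided ideal of finite $k$-codimension, with $\Delta(f)=\sum f_1\otimes f_2$ determined by $f(pq)=\sum f_1(p)f_2(q)$ and $\varepsilon(f)=f(1)$. Then $\mathcal{DC}(D,\mathrm{id})$ and $D[[x]]^\circ$ are isomorphic as $k$-coalgebras. -/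

import Mathlib

open scoped TensorProduct

noncomputable section

universe u v

/-! ### Naturality of the associator -/

section Assoc

variable {k : Type*} [Field k] {A B E A' B' E' F : Type*}
  [AddCommGroup A] [Module k A] [AddCommGroup B] [Module k B] [AddCommGroup E] [Module k E]
  [AddCommGroup A'] [Module k A'] [AddCommGroup B'] [Module k B'] [AddCommGroup E'] [Module k E']
  [AddCommGroup F] [Module k F]

theorem assoc_lTensor (g : E →ₗ[k] E') (y : (A ⊗[k] B) ⊗[k] E) :
    TensorProduct.assoc k A B E' (g.lTensor (A ⊗[k] B) y) =
      (g.lTensor B).lTensor A (TensorProduct.assoc k A B E y) :=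
  LinearMap.congr_fun (TensorProduct.ext_threefold (g := (TensorProduct.assoc k A B E').toLinearMap
    ∘ₗ g.lTensor (A ⊗[k] B)) (h := (g.lTensor B).lTensor A ∘ₗ
      (TensorProduct.assoc k A B E).toLinearMap) (fun _ _ _ => by simp)) y

theorem assoc_lTensor_rTensor (g : B →ₗ[k] B') (y : (A ⊗[k] B) ⊗[k] E) :
    TensorProduct.assoc k A B' E ((g.lTensor A).rTensor E y) =
      (g.rTensor E).lTensor A (TensorProduct.assoc k A B E y) :=
  LinearMap.congr_fun (TensorProduct.ext_threefold (g := (TensorProduct.assoc k A B' E).toLinearMap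
    ∘ₗ (g.lTensor A).rTensor E) (h := (g.rTensor E).lTensor A ∘ₗ
      (TensorProduct.assoc k A B E).toLinearMap) (fun _ _ _ => by simp)) y

theorem assoc_rTensor (g : A →ₗ[k] A') (y : (A ⊗[k] B) ⊗[k] E) :
    TensorProduct.assoc k A' B E ((g.rTensor B).rTensor E y) =
      g.rTensor (B ⊗[k] E) (TensorProduct.assoc k A B E y) :=
  LinearMap.congr_fun (TensorProduct.ext_threefold (g := (TensorProduct.assoc k A' B E).toLinearMap
    ∘ₗ (g.rTensor B).rTensor E) (h := g.rTensor (B ⊗[k] E) ∘ₗ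
      (TensorProduct.assoc k A B E).toLinearMap) (fun _ _ _ => by simp)) y

theorem lTensor_rTensor_comm (f : A →ₗ[k] A') (g : B →ₗ[k] B') (y : A ⊗[k] B) :
    g.lTensor A' (f.rTensor B y) = f.rTensor B' (g.lTensor A y) :=
  LinearMap.congr_fun (TensorProduct.ext' (g := g.lTensor A' ∘ₗ f.rTensor B)
    (h := f.rTensor B' ∘ₗ g.lTensor A) (fun _ _ => by simp)) y

theorem assoc_pentagon (y : ((A ⊗[k] B) ⊗[k] E) ⊗[k] F) :
    TensorProduct.assoc k A B (E ⊗[k] F) (TensorProduct.assoc k (A ⊗[k] B) E F y) =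
      (TensorProduct.assoc k B E F).toLinearMap.lTensor A
        (TensorProduct.assoc k A (B ⊗[k] E) F
          ((TensorProduct.assoc k A B E).toLinearMap.rTensor F y)) :=
  LinearMap.congr_fun (TensorProduct.ext_fourfold
    (g := (TensorProduct.assoc k A B (E ⊗[k] F)).toLinearMap ∘ₗ
      (TensorProduct.assoc k (A ⊗[k] B) E F).toLinearMap)
    (h := (TensorProduct.assoc k B E F).toLinearMap.lTensor A ∘ₗ
      (TensorProduct.assoc k A (B ⊗[k] E) F).toLinearMap ∘ₗ
        (TensorProduct.assoc k A B E).toLinearMap.rTensor F) (fun _ _ _ _ => by simp)) y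

end Assoc

/-! ### Restricting maps to equalizers tensored with a vector space -/

section Equalizer

variable {k : Type*} [Field k] {V W U X : Type*}
  [AddCommGroup V] [Module k V] [AddCommGroup W] [Module k W]
  [AddCommGroup U] [Module k U] [AddCommGroup X] [Module k X]

theorem eqLocus_subtype_rTensor_injective (f g : V →ₗ[k] W) :
    Function.Injective ((LinearMap.eqLocus f g).subtype.rTensor U) :=
  Module.Flat.rTensor_preserves_injective_linearMap _ (Submodule.injective_subtype _)

theorem eqLocus_subtype_lTensor_injective (f g : V →ₗ[k] W) :
    Function.Injective ((LinearMap.eqLocus f g).subtype.lTensor U) :=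
  Module.Flat.lTensor_preserves_injective_linearMap _ (Submodule.injective_subtype _)

theorem mem_range_eqLocus_rTensor (f g : V →ₗ[k] W) (x : V ⊗[k] U)
    (h : f.rTensor U x = g.rTensor U x) :
    x ∈ LinearMap.range ((LinearMap.eqLocus f g).subtype.rTensor U) := by
  rw [LinearMap.eqLocus_eq_ker_sub]
  have := Module.Flat.rTensor_exact U (LinearMap.exact_subtype_ker_map (f - g))
  refine (this x).1 ?_
  rw [LinearMap.rTensor_sub, LinearMap.sub_apply, h, sub_self]

theorem mem_range_eqLocus_lTensor (f g : V →ₗ[k] W) (x : U ⊗[k] V)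
    (h : f.lTensor U x = g.lTensor U x) :
    x ∈ LinearMap.range ((LinearMap.eqLocus f g).subtype.lTensor U) := by
  rw [LinearMap.eqLocus_eq_ker_sub]
  have := Module.Flat.lTensor_exact U (LinearMap.exact_subtype_ker_map (f - g))
  refine (this x).1 ?_
  rw [LinearMap.lTensor_sub, LinearMap.sub_apply, h, sub_self]

/-- A linear map `h : X → V ⊗ U` with `(f ⊗ U) h = (g ⊗ U) h`, as a map to `Eq(f, g) ⊗ U`. -/
def liftEqLocusR (f g : V →ₗ[k] W) (h : X →ₗ[k] V ⊗[k] U)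
    (hh : ∀ x, f.rTensor U (h x) = g.rTensor U (h x)) :
    X →ₗ[k] LinearMap.eqLocus f g ⊗[k] U :=
  LinearMap.codRestrictOfInjective h ((LinearMap.eqLocus f g).subtype.rTensor U)
    (eqLocus_subtype_rTensor_injective f g) (fun x => mem_range_eqLocus_rTensor f g _ (hh x))

theorem liftEqLocusR_spec (f g : V →ₗ[k] W) (h : X →ₗ[k] V ⊗[k] U)
    (hh : ∀ x, f.rTensor U (h x) = g.rTensor U (h x)) (x : X) :
    (LinearMap.eqLocus f g).subtype.rTensor U (liftEqLocusR f g h hh x) = h x :=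
  LinearMap.codRestrictOfInjective_comp_apply _ _ _ _ x

/-- A linear map `h : X → U ⊗ V` with `(U ⊗ f) h = (U ⊗ g) h`, as a map to `U ⊗ Eq(f, g)`. -/
def liftEqLocusL (f g : V →ₗ[k] W) (h : X →ₗ[k] U ⊗[k] V)
    (hh : ∀ x, f.lTensor U (h x) = g.lTensor U (h x)) :
    X →ₗ[k] U ⊗[k] LinearMap.eqLocus f g :=
  LinearMap.codRestrictOfInjective h ((LinearMap.eqLocus f g).subtype.lTensor U)
    (eqLocus_subtype_lTensor_injective f g) (fun x => mem_range_eqLocus_lTensor f g _ (hh x))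

theorem liftEqLocusL_spec (f g : V →ₗ[k] W) (h : X →ₗ[k] U ⊗[k] V)
    (hh : ∀ x, f.lTensor U (h x) = g.lTensor U (h x)) (x : X) :
    (LinearMap.eqLocus f g).subtype.lTensor U (liftEqLocusL f g h hh x) = h x :=
  LinearMap.codRestrictOfInjective_comp_apply _ _ _ _ x

end Equalizer

/-! ### Bicomodules and the cotensor product -/

/-- A (counital) bicomodule over the `k`-coalgebra `C`. -/
structure Bicomodule (k : Type u) [Field k] (C : Type v) [AddCommGroup C] [Module k C]
    [Coalgebra k C] where
  /-- The underlying vector space. -/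
  carrier : Type v
  [addCommGroup : AddCommGroup carrier]
  [module : Module k carrier]
  /-- The left coaction. -/
  lco : carrier →ₗ[k] C ⊗[k] carrier
  /-- The right coaction. -/
  rco : carrier →ₗ[k] carrier ⊗[k] C
  lco_coassoc : ∀ m, TensorProduct.assoc k C C carrier
    ((Coalgebra.comul (R := k) (A := C)).rTensor carrier (lco m)) = lco.lTensor C (lco m)
  lco_counit : ∀ m, (Coalgebra.counit (R := k) (A := C)).rTensor carrier (lco m) = 1 ⊗ₜ[k] m
  rco_coassoc : ∀ m, TensorProduct.assoc k carrier C C (rco.rTensor C (rco m)) =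
    (Coalgebra.comul (R := k) (A := C)).lTensor carrier (rco m)
  rco_counit : ∀ m, (Coalgebra.counit (R := k) (A := C)).lTensor carrier (rco m) = m ⊗ₜ[k] 1
  /-- The two coactions commute. -/
  lco_rco : ∀ m, TensorProduct.assoc k C carrier C (lco.rTensor C (rco m)) =
    rco.lTensor C (lco m)

namespace Bicomodule

attribute [instance] Bicomodule.addCommGroup Bicomodule.module

variable {k : Type u} [Field k] {C : Type v} [AddCommGroup C] [Module k C] [Coalgebra k C]

variable (k C) in
/-- The coalgebra `C` as a bicomodule over itself. -/
def regular : Bicomodule k C where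
  carrier := C
  lco := Coalgebra.comul
  rco := Coalgebra.comul
  lco_coassoc m := Coalgebra.coassoc_apply m
  lco_counit m := Coalgebra.rTensor_counit_comul m
  rco_coassoc m := Coalgebra.coassoc_apply m
  rco_counit m := Coalgebra.lTensor_counit_comul m
  lco_rco m := Coalgebra.coassoc_apply m

/-- The map `ρʳ ⊗ N : M ⊗ N → M ⊗ C ⊗ N`. -/
def cotensorLeft (M N : Bicomodule k C) :
    M.carrier ⊗[k] N.carrier →ₗ[k] M.carrier ⊗[k] (C ⊗[k] N.carrier) :=
  (TensorProduct.assoc k M.carrier C N.carrier).toLinearMap ∘ₗ M.rco.rTensor N.carrier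

/-- The map `M ⊗ ρˡ : M ⊗ N → M ⊗ C ⊗ N`. -/
def cotensorRight (M N : Bicomodule k C) :
    M.carrier ⊗[k] N.carrier →ₗ[k] M.carrier ⊗[k] (C ⊗[k] N.carrier) :=
  N.lco.lTensor M.carrier

/-- The underlying vector space of the cotensor product `M □_C N`, the equalizer of
`ρʳ ⊗ N` and `M ⊗ ρˡ`. -/
def cotensorSpace (M N : Bicomodule k C) : Submodule k (M.carrier ⊗[k] N.carrier) :=
  LinearMap.eqLocus (cotensorLeft M N) (cotensorRight M N)

section Restrict

variable (M : Bicomodule k C) {N N' : Bicomodule k C} {U : Type*} [AddCommGroup U] [Module k U]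

/-- `d : N → N' ⊗ U` is a map of left `C`-comodules, where `C` coacts on `N' ⊗ U` through `N'`. -/
def IsLeftColinear (d : N.carrier →ₗ[k] N'.carrier ⊗[k] U) : Prop :=
  ∀ n, TensorProduct.assoc k C N'.carrier U (N'.lco.rTensor U (d n)) = d.lTensor C (N.lco n)

/-- `M ⊗ d`, as a map `M ⊗ N → (M ⊗ N') ⊗ U`. -/
def tensorMap (d : N.carrier →ₗ[k] N'.carrier ⊗[k] U) :
    M.carrier ⊗[k] N.carrier →ₗ[k] (M.carrier ⊗[k] N'.carrier) ⊗[k] U :=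
  (TensorProduct.assoc k M.carrier N'.carrier U).symm.toLinearMap ∘ₗ d.lTensor M.carrier

theorem assoc_tensorMap (d : N.carrier →ₗ[k] N'.carrier ⊗[k] U)
    (x : M.carrier ⊗[k] N.carrier) :
    TensorProduct.assoc k M.carrier N'.carrier U (tensorMap M d x) = d.lTensor M.carrier x := by
  simp [tensorMap]

/-- The canonical identification of `(M ⊗ (C ⊗ N')) ⊗ U` with `M ⊗ (C ⊗ (N' ⊗ U))`. -/
def reassoc (M N' : Bicomodule k C) (U : Type*) [AddCommGroup U] [Module k U] :
    (M.carrier ⊗[k] (C ⊗[k] N'.carrier)) ⊗[k] U ≃ₗ[k]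
      M.carrier ⊗[k] (C ⊗[k] (N'.carrier ⊗[k] U)) :=
  TensorProduct.assoc k M.carrier (C ⊗[k] N'.carrier) U ≪≫ₗ
    (TensorProduct.assoc k C N'.carrier U).lTensor M.carrier

theorem cotensorLeft_tensorMap (d : N.carrier →ₗ[k] N'.carrier ⊗[k] U)
    (x : M.carrier ⊗[k] N.carrier) :
    reassoc M N' U ((cotensorLeft M N').rTensor U (tensorMap M d x)) =
      (d.lTensor C).lTensor M.carrier (cotensorLeft M N x) := by
  simp only [reassoc, cotensorLeft, LinearMap.comp_apply, LinearMap.rTensor_comp,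
    LinearEquiv.trans_apply, LinearEquiv.coe_coe, ← assoc_lTensor, lTensor_rTensor_comm,
    ← assoc_tensorMap, ← assoc_rTensor]
  exact (assoc_pentagon _).symm

theorem cotensorRight_tensorMap (d : N.carrier →ₗ[k] N'.carrier ⊗[k] U) (hd : IsLeftColinear d)
    (x : M.carrier ⊗[k] N.carrier) :
    reassoc M N' U ((cotensorRight M N').rTensor U (tensorMap M d x)) =
      (d.lTensor C).lTensor M.carrier (cotensorRight M N x) := by
  have hd' : (TensorProduct.assoc k C N'.carrier U).toLinearMap ∘ₗ N'.lco.rTensor U ∘ₗ d =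
    d.lTensor C ∘ₗ N.lco := LinearMap.ext hd
  simp only [reassoc, cotensorRight, LinearEquiv.trans_apply, assoc_lTensor_rTensor,
    assoc_tensorMap]
  rw [← LinearMap.lTensor_comp_apply, ← LinearMap.lTensor_comp_apply, ← hd',
    LinearMap.lTensor_comp_apply, LinearMap.lTensor_comp_apply, LinearMap.lTensor_comp_apply]
  rfl

/-- The restriction `M □ N → (M □ N') ⊗ U` of `M ⊗ d`, for a map `d : N → N' ⊗ U` of left
`C`-comodules. -/
def cotensorMap (d : N.carrier →ₗ[k] N'.carrier ⊗[k] U) (hd : IsLeftColinear d) :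
    cotensorSpace M N →ₗ[k] cotensorSpace M N' ⊗[k] U :=
  liftEqLocusR (cotensorLeft M N') (cotensorRight M N')
    (tensorMap M d ∘ₗ (cotensorSpace M N).subtype) (fun x => by
      apply (reassoc M N' U).injective
      have hx : cotensorLeft M N x = cotensorRight M N x := x.2
      simp only [LinearMap.comp_apply, Submodule.subtype_apply, cotensorLeft_tensorMap,
        cotensorRight_tensorMap M d hd, hx])

theorem cotensorMap_spec (d : N.carrier →ₗ[k] N'.carrier ⊗[k] U) (hd : IsLeftColinear d)
    (x : cotensorSpace M N) :
    (cotensorSpace M N').subtype.rTensor U (cotensorMap M d hd x) = tensorMap M d x :=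
  liftEqLocusR_spec _ _ _ _ x

end Restrict

/-- `ρˡ ⊗ N`, as a map `M ⊗ N → C ⊗ (M ⊗ N)`. -/
def tensorLco (M N : Bicomodule k C) :
    M.carrier ⊗[k] N.carrier →ₗ[k] C ⊗[k] (M.carrier ⊗[k] N.carrier) :=
  (TensorProduct.assoc k C M.carrier N.carrier).toLinearMap ∘ₗ M.lco.rTensor N.carrier

/-- The left coaction of the cotensor product `M □ N`, restricting `ρˡ ⊗ N`. -/
def cotensorLco (M N : Bicomodule k C) :
    cotensorSpace M N →ₗ[k] C ⊗[k] cotensorSpace M N :=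
  liftEqLocusL (cotensorLeft M N) (cotensorRight M N)
    (tensorLco M N ∘ₗ (cotensorSpace M N).subtype) (fun x => by
      have hx : cotensorLeft M N x = cotensorRight M N x := x.2
      have h1 : ∀ y, (cotensorLeft M N).lTensor C (tensorLco M N y) =
          TensorProduct.assoc k C M.carrier (C ⊗[k] N.carrier)
            (M.lco.rTensor (C ⊗[k] N.carrier) (cotensorLeft M N y)) := by
        intro y
        have hl : (TensorProduct.assoc k C M.carrier C).toLinearMap ∘ₗ M.lco.rTensor C ∘ₗ M.rco =
          M.rco.lTensor C ∘ₗ M.lco := LinearMap.ext M.lco_rco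
        simp only [cotensorLeft, tensorLco, LinearMap.comp_apply, LinearMap.lTensor_comp,
          LinearEquiv.coe_coe, ← assoc_lTensor_rTensor, ← assoc_rTensor]
        rw [assoc_pentagon, ← LinearMap.rTensor_comp_apply, ← hl, LinearMap.rTensor_comp_apply,
          LinearMap.rTensor_comp_apply]
      have h2 : ∀ y, (cotensorRight M N).lTensor C (tensorLco M N y) =
          TensorProduct.assoc k C M.carrier (C ⊗[k] N.carrier)
            (M.lco.rTensor (C ⊗[k] N.carrier) (cotensorRight M N y)) := by
        intro y
        simp only [cotensorRight, tensorLco, LinearMap.comp_apply, LinearEquiv.coe_coe,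
          ← assoc_lTensor, lTensor_rTensor_comm]
      simp only [LinearMap.comp_apply, Submodule.subtype_apply, h1, h2, hx])

theorem cotensorLco_spec (M N : Bicomodule k C) (x : cotensorSpace M N) :
    (cotensorSpace M N).subtype.lTensor C (cotensorLco M N x) = tensorLco M N x :=
  liftEqLocusL_spec _ _ _ _ x

theorem rco_colinear (N : Bicomodule k C) : IsLeftColinear N.rco := N.lco_rco

theorem assoc_cotensorMap (M : Bicomodule k C) {N P Q : Bicomodule k C} {U W S : Type*}
    [AddCommGroup U] [Module k U] [AddCommGroup W] [Module k W] [AddCommGroup S] [Module k S]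
    (d₁ : N.carrier →ₗ[k] P.carrier ⊗[k] U) (h₁ : IsLeftColinear d₁)
    (d₂ : P.carrier →ₗ[k] Q.carrier ⊗[k] W) (h₂ : IsLeftColinear d₂)
    (d₃ : N.carrier →ₗ[k] Q.carrier ⊗[k] S) (h₃ : IsLeftColinear d₃)
    (e : S →ₗ[k] W ⊗[k] U)
    (H : ∀ n, TensorProduct.assoc k Q.carrier W U (d₂.rTensor U (d₁ n)) =
      e.lTensor Q.carrier (d₃ n)) (x : cotensorSpace M N) :
    TensorProduct.assoc k (cotensorSpace M Q) W U
      ((cotensorMap M d₂ h₂).rTensor U (cotensorMap M d₁ h₁ x)) =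
      e.lTensor (cotensorSpace M Q) (cotensorMap M d₃ h₃ x) := by
  apply eqLocus_subtype_rTensor_injective (cotensorLeft M Q) (cotensorRight M Q)
  change (cotensorSpace M Q).subtype.rTensor _ _ = (cotensorSpace M Q).subtype.rTensor _ _
  have h : (cotensorSpace M Q).subtype.rTensor W ∘ₗ cotensorMap M d₂ h₂ =
    tensorMap M d₂ ∘ₗ (cotensorSpace M P).subtype := LinearMap.ext (cotensorMap_spec M d₂ h₂)
  rw [← assoc_rTensor, ← LinearMap.rTensor_comp_apply, h, LinearMap.rTensor_comp_apply,
    cotensorMap_spec, ← lTensor_rTensor_comm, cotensorMap_spec]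
  apply (TensorProduct.assoc k M.carrier Q.carrier (W ⊗[k] U)).injective
  rw [assoc_lTensor, assoc_tensorMap, assoc_pentagon, ← LinearMap.rTensor_comp_apply]
  have h' : (TensorProduct.assoc k M.carrier Q.carrier W).toLinearMap ∘ₗ tensorMap M d₂ =
    d₂.lTensor M.carrier := LinearMap.ext (assoc_tensorMap M d₂)
  have H' : (TensorProduct.assoc k Q.carrier W U).toLinearMap ∘ₗ d₂.rTensor U ∘ₗ d₁ =
    e.lTensor Q.carrier ∘ₗ d₃ := LinearMap.ext H
  rw [h', assoc_lTensor_rTensor, assoc_tensorMap, ← LinearMap.lTensor_comp_apply,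
    ← LinearMap.lTensor_comp_apply, LinearMap.comp_assoc,
    ← LinearMap.lTensor_comp_apply, H']

theorem cotensorMap_colinear (M : Bicomodule k C) {N N' : Bicomodule k C} {U : Type*}
    [AddCommGroup U] [Module k U] (d : N.carrier →ₗ[k] N'.carrier ⊗[k] U)
    (hd : IsLeftColinear d) (x : cotensorSpace M N) :
    TensorProduct.assoc k C (cotensorSpace M N') U
      ((cotensorLco M N').rTensor U (cotensorMap M d hd x)) =
      (cotensorMap M d hd).lTensor C (cotensorLco M N x) := by
  apply Module.Flat.lTensor_preserves_injective_linearMap (M := C) _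
    (eqLocus_subtype_rTensor_injective (U := U) (cotensorLeft M N') (cotensorRight M N'))
  change ((cotensorSpace M N').subtype.rTensor U).lTensor C _ =
    ((cotensorSpace M N').subtype.rTensor U).lTensor C _
  have h₁ : (cotensorSpace M N').subtype.rTensor U ∘ₗ cotensorMap M d hd =
    tensorMap M d ∘ₗ (cotensorSpace M N).subtype := LinearMap.ext (cotensorMap_spec M d hd)
  have h₂ : (cotensorSpace M N').subtype.lTensor C ∘ₗ cotensorLco M N' =
    tensorLco M N' ∘ₗ (cotensorSpace M N').subtype := LinearMap.ext (cotensorLco_spec M N')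
  rw [← LinearMap.lTensor_comp_apply, h₁, LinearMap.lTensor_comp_apply, cotensorLco_spec,
    ← assoc_lTensor_rTensor, ← LinearMap.rTensor_comp_apply, h₂, LinearMap.rTensor_comp_apply,
    cotensorMap_spec]
  apply ((TensorProduct.assoc k M.carrier N'.carrier U).lTensor C).injective
  change (TensorProduct.assoc k M.carrier N'.carrier U).toLinearMap.lTensor C _ =
    (TensorProduct.assoc k M.carrier N'.carrier U).toLinearMap.lTensor C _
  have h' : (TensorProduct.assoc k M.carrier N'.carrier U).toLinearMap ∘ₗ tensorMap M d =
    d.lTensor M.carrier := LinearMap.ext (assoc_tensorMap M d)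
  rw [← LinearMap.lTensor_comp_apply C _ (tensorMap M d), h', tensorLco, tensorLco,
    LinearMap.rTensor_comp, LinearMap.comp_apply, LinearMap.comp_apply, ← assoc_pentagon,
    assoc_rTensor, assoc_tensorMap, LinearEquiv.coe_coe, ← assoc_lTensor, lTensor_rTensor_comm]

/-- The cotensor product `M □_C N` of two bicomodules, with the coactions `ρˡ ⊗ N` and `M ⊗ ρʳ`. -/
def cotensor (M N : Bicomodule k C) : Bicomodule k C where
  carrier := cotensorSpace M N
  lco := cotensorLco M N
  rco := cotensorMap M N.rco N.rco_colinear
  lco_coassoc x := by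
    apply Module.Flat.lTensor_preserves_injective_linearMap (M := C) _
      (eqLocus_subtype_lTensor_injective (U := C) (cotensorLeft M N) (cotensorRight M N))
    have h : (cotensorSpace M N).subtype.lTensor C ∘ₗ cotensorLco M N =
      tensorLco M N ∘ₗ (cotensorSpace M N).subtype := LinearMap.ext (cotensorLco_spec M N)
    change ((cotensorSpace M N).subtype.lTensor C).lTensor C _ =
      ((cotensorSpace M N).subtype.lTensor C).lTensor C _
    rw [← LinearMap.lTensor_comp_apply, h, LinearMap.lTensor_comp_apply, cotensorLco_spec,
      ← assoc_lTensor, lTensor_rTensor_comm, cotensorLco_spec]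
    have hl : (TensorProduct.assoc k C C M.carrier).toLinearMap ∘ₗ
        (Coalgebra.comul (R := k) (A := C)).rTensor M.carrier ∘ₗ M.lco =
      M.lco.lTensor C ∘ₗ M.lco := LinearMap.ext M.lco_coassoc
    simp only [tensorLco, LinearMap.comp_apply, LinearMap.lTensor_comp,
      LinearEquiv.coe_coe, ← assoc_lTensor_rTensor, ← assoc_rTensor]
    rw [assoc_pentagon, ← LinearMap.rTensor_comp_apply N.carrier (M.lco.lTensor C), ← hl,
      LinearMap.rTensor_comp_apply, LinearMap.rTensor_comp_apply]
  lco_counit x := by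
    apply Module.Flat.lTensor_preserves_injective_linearMap (M := k) _
      (Submodule.injective_subtype (cotensorSpace M N))
    rw [lTensor_rTensor_comm, cotensorLco_spec]
    have hl : (Coalgebra.counit (R := k) (A := C)).rTensor M.carrier ∘ₗ M.lco =
      TensorProduct.mk k k M.carrier 1 := LinearMap.ext M.lco_counit
    simp only [tensorLco, LinearMap.comp_apply, LinearEquiv.coe_coe, ← assoc_rTensor,
      LinearMap.lTensor_tmul, Submodule.subtype_apply]
    rw [← LinearMap.rTensor_comp_apply, hl]
    generalize (x : M.carrier ⊗[k] N.carrier) = y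
    induction y with
    | zero => simp
    | add a b ha hb => simp [ha, hb, TensorProduct.tmul_add]
    | tmul a b => simp
  rco_coassoc x := assoc_cotensorMap M N.rco N.rco_colinear N.rco N.rco_colinear N.rco N.rco_colinear _
    N.rco_coassoc x
  rco_counit x := by
    apply Module.Flat.rTensor_preserves_injective_linearMap (M := k) _
      (Submodule.injective_subtype (cotensorSpace M N))
    rw [← lTensor_rTensor_comm, cotensorMap_spec M N.rco N.rco_colinear]
    apply (TensorProduct.assoc k M.carrier N.carrier k).injective
    have hl : (Coalgebra.counit (R := k) (A := C)).lTensor N.carrier ∘ₗ N.rco =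
      (TensorProduct.mk k N.carrier k).flip 1 := LinearMap.ext N.rco_counit
    rw [assoc_lTensor, assoc_tensorMap, ← LinearMap.lTensor_comp_apply, hl,
      LinearMap.rTensor_tmul, Submodule.subtype_apply]
    generalize (x : M.carrier ⊗[k] N.carrier) = y
    induction y with
    | zero => simp
    | add a b ha hb => simp [ha, hb, TensorProduct.add_tmul]
    | tmul a b => simp
  lco_rco x := cotensorMap_colinear M N.rco N.rco_colinear x

/-- The cotensor powers `M^{□ n}` of a `C`-bicomodule, with `M^{□ 0} = C`. -/
def pow (M : Bicomodule k C) : ℕ → Bicomodule k C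
  | 0 => regular k C
  | 1 => M
  | n + 2 => cotensor M (pow M (n + 1))

/-- The component `M^{□ (j + i)} → M^{□ i} ⊗ M^{□ j}` of the comultiplication of the cotensor
coalgebra, together with the fact that it is a map of left `C`-comodules. It is the left coaction
for `i = 0`, the right coaction of `M` for `(i, j) = (1, 0)`, and in the other cases it splits
`m₁ □ ⋯ □ mᵢ₊ⱼ` as `(m₁ □ ⋯ □ mᵢ) ⊗ (mᵢ₊₁ □ ⋯ □ mᵢ₊ⱼ)`, or coacts on the last factor if `j = 0`. -/
def split (M : Bicomodule k C) : (i j : ℕ) →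
    {d : (pow M (j + i)).carrier →ₗ[k] (pow M i).carrier ⊗[k] (pow M j).carrier //
      IsLeftColinear d}
  | 0, j => ⟨(pow M j).lco, (pow M j).lco_coassoc⟩
  | 1, 0 => ⟨M.rco, M.rco_colinear⟩
  | 1, j + 1 => ⟨(cotensorSpace M (pow M (j + 1))).subtype,
      fun x => (cotensorLco_spec M (pow M (j + 1)) x).symm⟩
  | i + 2, j => ⟨cotensorMap M (split M (i + 1) j).1 (split M (i + 1) j).2,
      cotensorMap_colinear M (split M (i + 1) j).1 (split M (i + 1) j).2⟩

/-- `split` with a free source index `n`, extended by `0` to `n ≠ j + i`. -/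
def splitAt (M : Bicomodule k C) (i j n : ℕ) :
    (pow M n).carrier →ₗ[k] (pow M i).carrier ⊗[k] (pow M j).carrier :=
  if h : j + i = n then h ▸ (split M i j).1 else 0

theorem splitAt_eq (M : Bicomodule k C) (i j : ℕ) : splitAt M i j (j + i) = (split M i j).1 := by
  simp [splitAt]

theorem splitAt_colinear (M : Bicomodule k C) (i j n : ℕ) : IsLeftColinear (splitAt M i j n) := by
  by_cases h : j + i = n
  · subst h
    rw [splitAt_eq]
    exact (split M i j).2
  · intro x
    simp [splitAt, h]

theorem splitAt_zero (M : Bicomodule k C) (j : ℕ) : splitAt M 0 j j = (pow M j).lco :=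
  splitAt_eq M 0 j

theorem splitAt_one_zero (M : Bicomodule k C) : splitAt M 1 0 1 = M.rco :=
  splitAt_eq M 1 0

theorem splitAt_one_succ (M : Bicomodule k C) (j : ℕ) :
    splitAt M 1 (j + 1) (j + 2) = (cotensorSpace M (pow M (j + 1))).subtype :=
  splitAt_eq M 1 (j + 1)

theorem splitAt_succ_succ (M : Bicomodule k C) (i j n : ℕ) (h : j + i = n) :
    splitAt M (i + 2) j (n + 2) =
      cotensorMap M (splitAt M (i + 1) j (n + 1)) (splitAt_colinear M (i + 1) j (n + 1)) := by
  subst h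
  have h₁ : splitAt M (i + 1) j (j + i + 1) = (split M (i + 1) j).1 := splitAt_eq M (i + 1) j
  refine (splitAt_eq M (i + 2) j).trans ?_
  change cotensorMap M (split M (i + 1) j).1 (split M (i + 1) j).2 = _
  congr 1
  exact h₁.symm

theorem splitAt_coassoc (M : Bicomodule k C) : ∀ (a b c p q n : ℕ) (_ : b + a = p) (_ : c + b = q)
    (_ : q + a = n) (x : (pow M n).carrier),
    TensorProduct.assoc k (pow M a).carrier (pow M b).carrier (pow M c).carrier
      ((splitAt M a b p).rTensor (pow M c).carrier (splitAt M p c n x)) =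
      (splitAt M b c q).lTensor (pow M a).carrier (splitAt M a q n x)
  | 0, b, c, p, q, n, hp, hq, hn, x => by
    obtain rfl : b = p := hp
    obtain rfl : q = n := hn
    rw [splitAt_zero, splitAt_zero]
    exact splitAt_colinear M b c q x
  | 1, 0, 0, p, q, n, hp, hq, hn, x => by
    obtain rfl : 1 = p := hp
    obtain rfl : 0 = q := hq
    obtain rfl : 1 = n := hn
    rw [splitAt_one_zero, splitAt_zero]
    exact M.rco_coassoc x
  | 1, 0, c + 1, p, q, n, hp, hq, hn, x => by
    obtain rfl : 1 = p := hp
    obtain rfl : c + 1 = q := hq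
    obtain rfl : c + 2 = n := hn
    rw [splitAt_one_zero, splitAt_one_succ, splitAt_zero]
    exact x.2
  | 1, b + 1, c, p, q, n, hp, hq, hn, x => by
    obtain rfl : b + 2 = p := hp
    obtain rfl : c + b + 1 = q := hq
    obtain rfl : c + b + 2 = n := hn
    rw [splitAt_one_succ, splitAt_one_succ, splitAt_succ_succ M b c (c + b) rfl]
    exact (congrArg _ (cotensorMap_spec M _ _ x)).trans (assoc_tensorMap M _ _)
  | a + 2, b, c, p, q, n, hp, hq, hn, x => by
    obtain rfl : b + a + 2 = p := hp
    obtain rfl : q + a + 2 = n := hn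
    rw [splitAt_succ_succ M a b (b + a) rfl, splitAt_succ_succ M a q (q + a) rfl,
      splitAt_succ_succ M (b + a) c (q + a) (by omega)]
    exact assoc_cotensorMap M _ _ _ _ _ _ _
      (splitAt_coassoc M (a + 1) b c (b + a + 1) q (q + a + 1) rfl hq rfl) x

/-- The comultiplication has counit `ε_C` on the left. -/
theorem splitAt_counit_left (M : Bicomodule k C) (n : ℕ) (x : (pow M n).carrier) :
    (Coalgebra.counit (R := k) (A := C)).rTensor (pow M n).carrier (splitAt M 0 n n x) =
      1 ⊗ₜ[k] x := by
  rw [splitAt_zero]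
  exact (pow M n).lco_counit x

/-- The components landing in `M^{□ n} ⊗ C` are the right coactions. -/
theorem splitAt_right (M : Bicomodule k C) : ∀ n : ℕ, splitAt M n 0 n = (pow M n).rco
  | 0 => splitAt_zero M 0
  | 1 => splitAt_one_zero M
  | n + 2 => by
    rw [splitAt_succ_succ M n 0 n (Nat.zero_add n)]
    change _ = cotensorMap M (pow M (n + 1)).rco (pow M (n + 1)).rco_colinear
    congr 1
    exact splitAt_right M (n + 1)

theorem splitAt_counit_right (M : Bicomodule k C) (n : ℕ) (x : (pow M n).carrier) :
    (Coalgebra.counit (R := k) (A := C)).lTensor (pow M n).carrier (splitAt M n 0 n x) =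
      x ⊗ₜ[k] 1 := by
  rw [splitAt_right]
  exact (pow M n).rco_counit x

end Bicomodule

/-! ### The cotensor coalgebra -/

/-- The cotensor coalgebra `T_C(M) = ⨁ₙ M^{□ n}` of a `C`-bicomodule `M`. -/
def CotensorCoalgebra {k : Type u} [Field k] {C : Type v} [AddCommGroup C] [Module k C]
    [Coalgebra k C] (M : Bicomodule k C) : Type v :=
  DirectSum ℕ fun n => (M.pow n).carrier

namespace CotensorCoalgebra

variable {k : Type u} [Field k] {C : Type v} [AddCommGroup C] [Module k C] [Coalgebra k C]

instance (M : Bicomodule k C) : AddCommGroup (CotensorCoalgebra M) :=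
  inferInstanceAs (AddCommGroup (DirectSum ℕ fun n => (M.pow n).carrier))

instance (M : Bicomodule k C) : Module k (CotensorCoalgebra M) :=
  inferInstanceAs (Module k (DirectSum ℕ fun n => (M.pow n).carrier))

/-- The inclusion `M^{□ n} → T_C(M)`. -/
def incl (M : Bicomodule k C) (n : ℕ) : (M.pow n).carrier →ₗ[k] CotensorCoalgebra M :=
  DirectSum.lof k ℕ (fun n => (M.pow n).carrier) n

/-- The linear map out of `T_C(M)` with given components. -/
def fromSum (M : Bicomodule k C) {V : Type*} [AddCommGroup V] [Module k V]
    (f : ∀ n, (M.pow n).carrier →ₗ[k] V) : CotensorCoalgebra M →ₗ[k] V :=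
  DirectSum.toModule k ℕ V f

@[simp]
theorem fromSum_incl (M : Bicomodule k C) {V : Type*} [AddCommGroup V] [Module k V]
    (f : ∀ n, (M.pow n).carrier →ₗ[k] V) (n : ℕ) (x : (M.pow n).carrier) :
    fromSum M f (incl M n x) = f n x :=
  DirectSum.toModule_lof (R := k) (M := fun n => (M.pow n).carrier) (φ := f) n x

theorem hom_ext (M : Bicomodule k C) {V : Type*} [AddCommGroup V] [Module k V]
    {f g : CotensorCoalgebra M →ₗ[k] V} (h : ∀ n x, f (incl M n x) = g (incl M n x)) : f = g :=
  DirectSum.linearMap_ext k fun n => LinearMap.ext (h n)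

/-- The comultiplication `Δ` and the counit `ε` of `T_C(M)`: on `M^{□ n}`, `Δ` is the sum of its
components in `M^{□ i} ⊗ M^{□ j}` over all `i + j = n`, and `ε` is the counit of `C` on
`M^{□ 0} = C` and zero on `M^{□ n}` for `n > 0`. -/
instance (M : Bicomodule k C) : CoalgebraStruct k (CotensorCoalgebra M) where
  comul := fromSum M fun n => ∑ p ∈ Finset.HasAntidiagonal.antidiagonal n,
    TensorProduct.map (incl M p.1) (incl M p.2) ∘ₗ M.splitAt p.1 p.2 n
  counit := fromSum M fun n => match n with
    | 0 => (Coalgebra.counit (R := k) (A := C))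
    | _ + 1 => 0

theorem comul_incl (M : Bicomodule k C) (n : ℕ) (x : (M.pow n).carrier) :
    Coalgebra.comul (R := k) (incl M n x) = ∑ p ∈ Finset.HasAntidiagonal.antidiagonal n,
      TensorProduct.map (incl M p.1) (incl M p.2) (M.splitAt p.1 p.2 n x) := by
  refine (fromSum_incl M _ n x).trans ?_
  simp

theorem counit_incl_zero (M : Bicomodule k C) (x : C) :
    Coalgebra.counit (R := k) (incl M 0 x) = Coalgebra.counit (R := k) x :=
  fromSum_incl M _ 0 x

theorem counit_incl_succ (M : Bicomodule k C) (n : ℕ) (x : (M.pow (n + 1)).carrier) :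
    Coalgebra.counit (R := k) (incl M (n + 1) x) = 0 :=
  fromSum_incl M _ (n + 1) x

instance (M : Bicomodule k C) : Coalgebra k (CotensorCoalgebra M) where
  coassoc := by
    apply hom_ext
    intro n x
    simp only [LinearMap.comp_apply, comul_incl, map_sum, LinearEquiv.coe_coe]
    have hL : ∀ i j (y : (M.pow i).carrier ⊗[k] (M.pow j).carrier),
        (Coalgebra.comul (R := k)).rTensor (CotensorCoalgebra M)
          (TensorProduct.map (incl M i) (incl M j) y) =
        ∑ q ∈ Finset.HasAntidiagonal.antidiagonal i,
          TensorProduct.map (TensorProduct.map (incl M q.1) (incl M q.2)) (incl M j)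
            ((M.splitAt q.1 q.2 i).rTensor (M.pow j).carrier y) := by
      intro i j y
      induction y with
      | zero => simp
      | add a b ha hb => simp only [map_add, ha, hb, Finset.sum_add_distrib]
      | tmul a b => simp [comul_incl, TensorProduct.sum_tmul]
    have hR : ∀ i j (y : (M.pow i).carrier ⊗[k] (M.pow j).carrier),
        (Coalgebra.comul (R := k)).lTensor (CotensorCoalgebra M)
          (TensorProduct.map (incl M i) (incl M j) y) =
        ∑ q ∈ Finset.HasAntidiagonal.antidiagonal j,
          TensorProduct.map (incl M i) (TensorProduct.map (incl M q.1) (incl M q.2))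
            ((M.splitAt q.1 q.2 j).lTensor (M.pow i).carrier y) := by
      intro i j y
      induction y with
      | zero => simp
      | add a b ha hb => simp only [map_add, ha, hb, Finset.sum_add_distrib]
      | tmul a b => simp [comul_incl, TensorProduct.tmul_sum]
    simp only [hL, hR, map_sum, ← TensorProduct.map_map_assoc]
    rw [Finset.sum_sigma', Finset.sum_sigma']
    refine Finset.sum_nbij' (fun s => ⟨(s.2.1, s.2.2 + s.1.2), (s.2.2, s.1.2)⟩)
      (fun s => ⟨(s.1.1 + s.2.1, s.2.2), (s.1.1, s.2.1)⟩) ?_ ?_ ?_ ?_ ?_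
    · rintro ⟨⟨p, c⟩, a, b⟩ h
      simp only [Finset.mem_sigma, Finset.HasAntidiagonal.mem_antidiagonal] at h ⊢
      exact ⟨by omega, trivial⟩
    · rintro ⟨⟨p, c⟩, a, b⟩ h
      simp only [Finset.mem_sigma, Finset.HasAntidiagonal.mem_antidiagonal] at h ⊢
      exact ⟨by omega, trivial⟩
    · rintro ⟨⟨p, c⟩, a, b⟩ h
      simp only [Finset.mem_sigma, Finset.HasAntidiagonal.mem_antidiagonal] at h ⊢
      obtain ⟨-, rfl⟩ := h
      rfl
    · rintro ⟨⟨p, c⟩, a, b⟩ h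
      simp only [Finset.mem_sigma, Finset.HasAntidiagonal.mem_antidiagonal] at h ⊢
      obtain ⟨-, rfl⟩ := h
      rfl
    · rintro ⟨⟨p, c⟩, a, b⟩ h
      simp only [Finset.mem_sigma, Finset.HasAntidiagonal.mem_antidiagonal] at h ⊢
      rw [M.splitAt_coassoc a b c p (b + c) n (by omega) (by omega) (by omega)]
  rTensor_counit_comp_comul := by
    apply hom_ext
    intro n x
    have h : ∀ i j (y : (M.pow (i + 1)).carrier ⊗[k] (M.pow j).carrier),
        (Coalgebra.counit (R := k)).rTensor (CotensorCoalgebra M)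
          (TensorProduct.map (incl M (i + 1)) (incl M j) y) = 0 := by
      intro i j y
      induction y with
      | zero => simp
      | add a b ha hb => simp only [map_add, ha, hb, add_zero]
      | tmul a b => simp [counit_incl_succ]
    have h₀ : ∀ j (y : C ⊗[k] (M.pow j).carrier),
        (Coalgebra.counit (R := k)).rTensor (CotensorCoalgebra M)
          (TensorProduct.map (incl M 0) (incl M j) y) =
        (incl M j).lTensor k ((Coalgebra.counit (R := k) (A := C)).rTensor _ y) := by
      intro j y
      exact LinearMap.congr_fun (TensorProduct.ext'
        (g := (Coalgebra.counit (R := k)).rTensor (CotensorCoalgebra M) ∘ₗ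
          TensorProduct.map (incl M 0 : C →ₗ[k] CotensorCoalgebra M) (incl M j))
        (h := (incl M j).lTensor k ∘ₗ (Coalgebra.counit (R := k) (A := C)).rTensor _)
        (fun a b => congrArg (· ⊗ₜ[k] incl M j b) (counit_incl_zero M a))) y
    simp only [LinearMap.comp_apply, comul_incl, map_sum]
    rw [Finset.sum_eq_single (0, n)]
    · refine (h₀ n _).trans ?_
      refine (congrArg _ (M.splitAt_counit_left n x)).trans ?_
      simp
    · rintro ⟨i, j⟩ hij hne
      obtain _ | i := i
      · simp only [Finset.HasAntidiagonal.mem_antidiagonal] at hij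
        exact absurd (by rw [← hij, Nat.zero_add]) hne
      · exact h i j _
    · simp
  lTensor_counit_comp_comul := by
    apply hom_ext
    intro n x
    have h : ∀ i j (y : (M.pow i).carrier ⊗[k] (M.pow (j + 1)).carrier),
        (Coalgebra.counit (R := k)).lTensor (CotensorCoalgebra M)
          (TensorProduct.map (incl M i) (incl M (j + 1)) y) = 0 := by
      intro i j y
      induction y with
      | zero => simp
      | add a b ha hb => simp only [map_add, ha, hb, add_zero]
      | tmul a b => simp [counit_incl_succ]
    have h₀ : ∀ i (y : (M.pow i).carrier ⊗[k] C),
        (Coalgebra.counit (R := k)).lTensor (CotensorCoalgebra M)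
          (TensorProduct.map (incl M i) (incl M 0) y) =
        (incl M i).rTensor k ((Coalgebra.counit (R := k) (A := C)).lTensor _ y) := by
      intro i y
      exact LinearMap.congr_fun (TensorProduct.ext'
        (g := (Coalgebra.counit (R := k)).lTensor (CotensorCoalgebra M) ∘ₗ
          TensorProduct.map (incl M i) (incl M 0 : C →ₗ[k] CotensorCoalgebra M))
        (h := (incl M i).rTensor k ∘ₗ (Coalgebra.counit (R := k) (A := C)).lTensor _)
        (fun a b => congrArg (incl M i a ⊗ₜ[k] ·) (counit_incl_zero M b))) y
    simp only [LinearMap.comp_apply, comul_incl, map_sum]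
    rw [Finset.sum_eq_single (n, 0)]
    · refine (h₀ n _).trans ?_
      refine (congrArg _ (M.splitAt_counit_right n x)).trans ?_
      simp
    · rintro ⟨i, j⟩ hij hne
      obtain _ | j := j
      · simp only [Finset.HasAntidiagonal.mem_antidiagonal] at hij
        exact absurd (by rw [← hij, Nat.add_zero]) hne
      · exact h i j _
    · simp

end CotensorCoalgebra

/-! ### Dual coalgebras -/

section Dual

open Module

variable {k : Type u} [Field k]

theorem dualDistrib_injective (V W : Type*) [AddCommGroup V] [Module k V] [AddCommGroup W]
    [Module k W] : Function.Injective (TensorProduct.dualDistrib k V W) := by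
  rw [injective_iff_map_eq_zero]
  intro z hz
  classical
  let b := Basis.ofVectorSpace k (Dual k W)
  obtain ⟨c, rfl⟩ := (TensorProduct.equivFinsuppOfBasisRight (M := Dual k V) b).symm.surjective z
  rw [TensorProduct.equivFinsuppOfBasisRight_symm_apply] at hz ⊢
  have hc : c = 0 := by
    ext i v
    have h0 : Finsupp.linearCombination k b (c.mapRange (fun f : Dual k V => f v) rfl) = 0 := by
      ext w
      have := LinearMap.congr_fun hz (v ⊗ₜ[k] w)
      simp only [Finsupp.sum, map_sum, LinearMap.sum_apply, TensorProduct.dualDistrib_apply,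
        LinearMap.zero_apply] at this
      rw [Finsupp.linearCombination_apply, Finsupp.sum_mapRange_index (by simp)]
      simpa [Finsupp.sum] using this
    have := (linearIndependent_iff.1 b.linearIndependent) _ h0
    simpa using DFunLike.congr_fun this i
  simp [hc]

variable {A : Type*} [Ring A] [Algebra k A] {P : Type*} [AddCommGroup P] [Module k P]

/-- An element of `P ⊗ P`, for a space `P` of functionals on `A`, as a functional on `A ⊗ A`. -/
def evalTwo (ι : P →ₗ[k] Dual k A) : P ⊗[k] P →ₗ[k] Dual k (A ⊗[k] A) :=
  TensorProduct.dualDistrib k A A ∘ₗ TensorProduct.map ι ι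

@[simp]
theorem evalTwo_tmul (ι : P →ₗ[k] Dual k A) (p q : P) (a b : A) :
    evalTwo ι (p ⊗ₜ[k] q) (a ⊗ₜ[k] b) = ι p a * ι q b := rfl

theorem evalTwo_injective (ι : P →ₗ[k] Dual k A) (hι : Function.Injective ι) :
    Function.Injective (evalTwo ι) :=
  (dualDistrib_injective A A).comp (TensorProduct.map_injective_of_flat_flat ι ι hι hι)

/-- An element of `P ⊗ (P ⊗ P)` as a functional on `A ⊗ (A ⊗ A)`. -/
def evalThree (ι : P →ₗ[k] Dual k A) :
    P ⊗[k] (P ⊗[k] P) →ₗ[k] Dual k (A ⊗[k] (A ⊗[k] A)) :=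
  TensorProduct.dualDistrib k A (A ⊗[k] A) ∘ₗ TensorProduct.map ι (evalTwo ι)

theorem evalThree_injective (ι : P →ₗ[k] Dual k A) (hι : Function.Injective ι) :
    Function.Injective (evalThree ι) :=
  (dualDistrib_injective A (A ⊗[k] A)).comp
    (TensorProduct.map_injective_of_flat_flat ι (evalTwo ι) hι (evalTwo_injective ι hι))

/-- `ρ : P → P ⊗ P` is dual to the (not necessarily associative) product `m` on `A`. -/
def IsDualTo (ι : P →ₗ[k] Dual k A) (ρ : P →ₗ[k] P ⊗[k] P) (m : A → A → A) : Prop :=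
  ∀ p a b, evalTwo ι (ρ p) (a ⊗ₜ[k] b) = ι p (m a b)

theorem IsDualTo.coassoc {ι : P →ₗ[k] Dual k A} (hι : Function.Injective ι)
    {ρ σ τ υ : P →ₗ[k] P ⊗[k] P} {mρ mσ mτ mυ : A → A → A} (hρ : IsDualTo ι ρ mρ)
    (hσ : IsDualTo ι σ mσ) (hτ : IsDualTo ι τ mτ) (hυ : IsDualTo ι υ mυ)
    (h : ∀ a b c, mρ (mσ a b) c = mτ a (mυ b c)) (p : P) :
    TensorProduct.assoc k P P P (σ.rTensor P (ρ p)) = υ.lTensor P (τ p) := by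
  apply evalThree_injective ι hι
  have hL : ∀ (z : P ⊗[k] P) (a b c : A), evalThree ι (TensorProduct.assoc k P P P (σ.rTensor P z))
      (a ⊗ₜ[k] (b ⊗ₜ[k] c)) = evalTwo ι z (mσ a b ⊗ₜ[k] c) := by
    intro z a b c
    induction z with
    | zero => simp
    | add x y hx hy => simp only [map_add, LinearMap.add_apply, hx, hy]
    | tmul x y =>
      rw [evalTwo_tmul, ← hσ x a b, LinearMap.rTensor_tmul]
      generalize σ x = w
      induction w with
      | zero => simp
      | add u v hu hv =>
        simp only [TensorProduct.add_tmul, map_add, LinearMap.add_apply, hu, hv, add_mul]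
      | tmul u v => exact (mul_assoc (ι u a) (ι v b) (ι y c)).symm
  have hR : ∀ (z : P ⊗[k] P) (a b c : A), evalThree ι (υ.lTensor P z)
      (a ⊗ₜ[k] (b ⊗ₜ[k] c)) = evalTwo ι z (a ⊗ₜ[k] mυ b c) := by
    intro z a b c
    induction z with
    | zero => simp
    | add x y hx hy => simp only [map_add, LinearMap.add_apply, hx, hy]
    | tmul x y =>
      rw [evalTwo_tmul, ← hυ y b c]
      rfl
  refine TensorProduct.ext (LinearMap.ext fun a => TensorProduct.ext' fun b c => ?_)
  change evalThree ι _ (a ⊗ₜ[k] (b ⊗ₜ[k] c)) = evalThree ι _ (a ⊗ₜ[k] (b ⊗ₜ[k] c))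
  rw [hL, hR, hρ, hτ, h]

theorem IsDualTo.counit_left {ι : P →ₗ[k] Dual k A} (hι : Function.Injective ι)
    {ρ : P →ₗ[k] P ⊗[k] P} {m : A → A → A} (hρ : IsDualTo ι ρ m) (h : ∀ a, m 1 a = a) (p : P) :
    (LinearMap.applyₗ (1 : A) ∘ₗ ι : P →ₗ[k] k).rTensor P (ρ p) = 1 ⊗ₜ[k] p := by
  apply (TensorProduct.lid k P).injective
  apply hι
  ext a
  have key : ∀ z : P ⊗[k] P, ι (TensorProduct.lid k P
      ((LinearMap.applyₗ (1 : A) ∘ₗ ι : P →ₗ[k] k).rTensor P z)) a =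
      evalTwo ι z ((1 : A) ⊗ₜ[k] a) := by
    intro z
    induction z with
    | zero => simp
    | add x y hx hy => simp only [map_add, LinearMap.add_apply, hx, hy]
    | tmul x y => simp
  rw [key, hρ, h]
  simp

theorem IsDualTo.counit_right {ι : P →ₗ[k] Dual k A} (hι : Function.Injective ι)
    {ρ : P →ₗ[k] P ⊗[k] P} {m : A → A → A} (hρ : IsDualTo ι ρ m) (h : ∀ a, m a 1 = a) (p : P) :
    (LinearMap.applyₗ (1 : A) ∘ₗ ι : P →ₗ[k] k).lTensor P (ρ p) = p ⊗ₜ[k] 1 := by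
  apply (TensorProduct.rid k P).injective
  apply hι
  ext a
  have key : ∀ z : P ⊗[k] P, ι (TensorProduct.rid k P
      ((LinearMap.applyₗ (1 : A) ∘ₗ ι : P →ₗ[k] k).lTensor P z)) a =
      evalTwo ι z (a ⊗ₜ[k] (1 : A)) := by
    intro z
    induction z with
    | zero => simp
    | add x y hx hy => simp only [map_add, LinearMap.add_apply, hx, hy]
    | tmul x y => simp [mul_comm]
  rw [key, hρ, h]
  simp

/-- The comultiplication on a space `P` of functionals on an algebra `A`, such that for each `f ∈ P`
the functional `a ⊗ b ↦ f (a b)` lies in `P ⊗ P`: `Δ f = ∑ fᵢ ⊗ gᵢ` is determined by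
`f (a b) = ∑ fᵢ(a) gᵢ(b)`. -/
def comulOfFunctionals (ι : P →ₗ[k] Dual k A) (hι : Function.Injective ι)
    (H : ∀ p, (LinearMap.mul' k A).dualMap (ι p) ∈ LinearMap.range (evalTwo ι)) :
    P →ₗ[k] P ⊗[k] P :=
  LinearMap.codRestrictOfInjective ((LinearMap.mul' k A).dualMap ∘ₗ ι) (evalTwo ι)
    (evalTwo_injective ι hι) H

theorem comulOfFunctionals_isDualTo (ι : P →ₗ[k] Dual k A) (hι : Function.Injective ι)
    (H : ∀ p, (LinearMap.mul' k A).dualMap (ι p) ∈ LinearMap.range (evalTwo ι)) :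
    IsDualTo ι (comulOfFunctionals ι hι H) (fun a b => a * b) := fun p a b => by
  rw [comulOfFunctionals, LinearMap.codRestrictOfInjective_comp_apply]
  simp

/-- The coalgebra structure on such a space `P`, with counit `ε f = f 1`. -/
@[reducible]
def coalgebraOfFunctionals (ι : P →ₗ[k] Dual k A) (hι : Function.Injective ι)
    (H : ∀ p, (LinearMap.mul' k A).dualMap (ι p) ∈ LinearMap.range (evalTwo ι)) :
    Coalgebra k P where
  comul := comulOfFunctionals ι hι H
  counit := LinearMap.applyₗ (1 : A) ∘ₗ ι
  coassoc :=
    have h := comulOfFunctionals_isDualTo ι hι H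
    LinearMap.ext (h.coassoc hι h h h mul_assoc)
  rTensor_counit_comp_comul :=
    LinearMap.ext ((comulOfFunctionals_isDualTo ι hι H).counit_left hι one_mul)
  lTensor_counit_comp_comul :=
    LinearMap.ext ((comulOfFunctionals_isDualTo ι hι H).counit_right hι mul_one)

theorem mem_range_evalTwo_id (k : Type u) [Field k] (D : Type v) [Ring D] [Algebra k D]
    [FiniteDimensional k D] (φ : Dual k (D ⊗[k] D)) :
    φ ∈ LinearMap.range (evalTwo (k := k) (A := D) LinearMap.id) :=
  ⟨(TensorProduct.dualDistribEquiv k D D).symm φ, by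
    rw [evalTwo, TensorProduct.map_id, LinearMap.comp_id]
    exact (TensorProduct.dualDistribEquiv k D D).apply_symm_apply φ⟩

/-- The dual coalgebra `D^*` of a finite-dimensional algebra `D`. -/
instance dualCoalgebra (k : Type u) [Field k] (D : Type v) [Ring D] [Algebra k D]
    [FiniteDimensional k D] : Coalgebra k (Dual k D) :=
  coalgebraOfFunctionals (P := Dual k D) LinearMap.id Function.injective_id
    (fun _ => mem_range_evalTwo_id k D _)

theorem dualCoalgebra_isDualTo (k : Type u) [Field k] (D : Type v) [Ring D] [Algebra k D]
    [FiniteDimensional k D] :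
    IsDualTo (A := D) (P := Dual k D) LinearMap.id (Coalgebra.comul (R := k) (A := Dual k D))
      (fun a b => a * b) :=
  comulOfFunctionals_isDualTo (A := D) (P := Dual k D) LinearMap.id Function.injective_id
    (fun _ => mem_range_evalTwo_id k D _)

/-- The finite dual `A° ⊆ A^*`: the functionals that vanish on some two-sided ideal of finite
codimension. -/
def finiteDual (k : Type u) [Field k] (A : Type v) [Ring A] [Algebra k A] :
    Submodule k (Dual k A) where
  carrier := {f | ∃ I : Ideal A, I.IsTwoSided ∧ FiniteDimensional k (A ⧸ I.restrictScalars k) ∧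
    ∀ a ∈ I, f a = 0}
  zero_mem' := by
    refine ⟨⊤, inferInstance, ?_, fun _ _ => rfl⟩
    exact (Submodule.CoFG.top : (⊤ : Submodule k A).CoFG)
  add_mem' := by
    rintro f g ⟨I, hI, hI', hf⟩ ⟨J, hJ, hJ', hg⟩
    refine ⟨I ⊓ J, ⟨fun b h => ⟨I.mul_mem_right b h.1, J.mul_mem_right b h.2⟩⟩, ?_, ?_⟩
    · exact Submodule.CoFG.inf (S := I.restrictScalars k) (T := J.restrictScalars k) hI' hJ'
    · intro a ha
      rw [LinearMap.add_apply, hf a ha.1, hg a ha.2, add_zero]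
  smul_mem' := by
    rintro c f ⟨I, hI, hI', hf⟩
    exact ⟨I, hI, hI', fun a ha => by rw [LinearMap.smul_apply, hf a ha, smul_zero]⟩

/-- The finite dual `A°` as a type. -/
def FiniteDual (k : Type u) [Field k] (A : Type v) [Ring A] [Algebra k A] : Type (max u v) :=
  finiteDual k A

instance (k : Type u) [Field k] (A : Type v) [Ring A] [Algebra k A] :
    AddCommGroup (FiniteDual k A) :=
  inferInstanceAs (AddCommGroup (finiteDual k A))

instance (k : Type u) [Field k] (A : Type v) [Ring A] [Algebra k A] :
    Module k (FiniteDual k A) :=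
  inferInstanceAs (Module k (finiteDual k A))

/-- The inclusion `A° → A^*`. -/
def FiniteDual.incl (k : Type u) [Field k] (A : Type v) [Ring A] [Algebra k A] :
    FiniteDual k A →ₗ[k] Dual k A :=
  (finiteDual k A).subtype

theorem FiniteDual.incl_injective (k : Type u) [Field k] (A : Type v) [Ring A] [Algebra k A] :
    Function.Injective (FiniteDual.incl k A) :=
  Submodule.injective_subtype _

theorem FiniteDual.mem_range_evalTwo (k : Type u) [Field k] (A : Type v) [Ring A] [Algebra k A]
    (f : FiniteDual k A) :
    (LinearMap.mul' k A).dualMap (FiniteDual.incl k A f) ∈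
      LinearMap.range (evalTwo (FiniteDual.incl k A)) := by
  obtain ⟨f, I, hI, hI', hf⟩ := f
  let π : A →ₗ[k] (A ⧸ I.restrictScalars k) := (I.restrictScalars k).mkQ
  obtain ⟨s, hs⟩ := π.exists_rightInverse_of_surjective (Submodule.range_mkQ _)
  have hs' : ∀ a, a - s (π a) ∈ I := fun a => by
    change a - s (π a) ∈ I.restrictScalars k
    rw [← Submodule.Quotient.mk_eq_zero, Submodule.Quotient.mk_sub, sub_eq_zero]
    exact (LinearMap.congr_fun hs (π a)).symm
  let r : Dual k (A ⧸ I.restrictScalars k) →ₗ[k] FiniteDual k A :=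
    LinearMap.codRestrict (finiteDual k A) π.dualMap (fun g => ⟨I, hI, hI', fun a ha => by
      change g (π a) = 0
      rw [show π a = 0 from (Submodule.Quotient.mk_eq_zero _).2 ha, map_zero]⟩)
  let w := (TensorProduct.dualDistribEquiv k _ _).symm
    (f ∘ₗ LinearMap.mul' k A ∘ₗ TensorProduct.map s s)
  refine ⟨TensorProduct.map r r w, TensorProduct.ext' fun a b => ?_⟩
  have key : ∀ z, evalTwo (FiniteDual.incl k A) (TensorProduct.map r r z) (a ⊗ₜ[k] b) =
      TensorProduct.dualDistrib k _ _ z (π a ⊗ₜ[k] π b) := by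
    intro z
    induction z with
    | zero => simp
    | add x y hx hy => simp only [map_add, LinearMap.add_apply, hx, hy]
    | tmul x y => rfl
  rw [key]
  have hw : TensorProduct.dualDistrib k _ _ w = f ∘ₗ LinearMap.mul' k A ∘ₗ TensorProduct.map s s :=
    (TensorProduct.dualDistribEquiv k _ _).apply_symm_apply _
  rw [hw]
  change f (s (π a) * s (π b)) = f (a * b)
  rw [eq_comm, ← sub_eq_zero, ← map_sub]
  apply hf
  have : a * b - s (π a) * s (π b) = (a - s (π a)) * b + s (π a) * (b - s (π b)) := by
    noncomm_ring
  rw [this]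
  exact I.add_mem (I.mul_mem_right _ (hs' a)) (I.mul_mem_left _ (hs' b))

/-- The finite dual coalgebra `A°`. -/
instance finiteDualCoalgebra (k : Type u) [Field k] (A : Type v) [Ring A] [Algebra k A] :
    Coalgebra k (FiniteDual k A) :=
  coalgebraOfFunctionals (FiniteDual.incl k A) (FiniteDual.incl_injective k A)
    (FiniteDual.mem_range_evalTwo k A)

theorem finiteDualCoalgebra_isDualTo (k : Type u) [Field k] (A : Type v) [Ring A] [Algebra k A] :
    IsDualTo (FiniteDual.incl k A) (Coalgebra.comul (R := k)) (fun a b => a * b) :=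
  comulOfFunctionals_isDualTo (FiniteDual.incl k A) (FiniteDual.incl_injective k A)
    (FiniteDual.mem_range_evalTwo k A)

theorem finiteDualCoalgebra_counit (k : Type u) [Field k] (A : Type v) [Ring A] [Algebra k A]
    (f : FiniteDual k A) : Coalgebra.counit (R := k) f = FiniteDual.incl k A f 1 := rfl

/-! ### The coalgebra `DC(D, α)` -/

variable (k) in
/-- The `D^*`-bicomodule `(D_α)^*` dual to the `D`-bimodule `D_α`, which is `D` with the actions
`a ▹ x = a x` and `x ◃ b = x α(b)`. The left coaction is dual to `▹` and the right coaction is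
dual to `◃`. -/
def twistedDual {D : Type v} [Ring D] [Algebra k D] [FiniteDimensional k D] (α : D ≃ₐ[k] D) :
    Bicomodule k (Dual k D) :=
  have hl := dualCoalgebra_isDualTo k D
  have hr : IsDualTo (A := D) LinearMap.id (α.toLinearMap.dualMap.lTensor (Dual k D) ∘ₗ
      Coalgebra.comul (R := k) (A := Dual k D)) (fun x b => x * α b) := fun p x b => by
    rw [← hl p x (α b), LinearMap.comp_apply]
    generalize Coalgebra.comul (R := k) p = z
    induction z with
    | zero => simp
    | add x y hx hy => simp only [map_add, LinearMap.add_apply, hx, hy]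
    | tmul x y => rfl
  { carrier := Dual k D
    lco := Coalgebra.comul
    rco := α.toLinearMap.dualMap.lTensor (Dual k D) ∘ₗ Coalgebra.comul
    lco_coassoc := Coalgebra.coassoc_apply
    lco_counit := Coalgebra.rTensor_counit_comul
    rco_coassoc := hr.coassoc Function.injective_id hr hr hl (fun x b c => by
      rw [map_mul, mul_assoc])
    rco_counit := hr.counit_right Function.injective_id (fun x => by rw [map_one, mul_one])
    lco_rco := hr.coassoc Function.injective_id hl hl hr (fun a x b => mul_assoc a x (α b)) }

variable (k) in
/-- The coalgebra `DC(D, α) = T_{D^*}((D_α)^*)`. -/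
abbrev DC {D : Type v} [DivisionRing D] [Algebra k D] [FiniteDimensional k D] (α : D ≃ₐ[k] D) :
    Type (max u v) :=
  CotensorCoalgebra (twistedDual k α)

end Dual

end

/-!
Since `C □_C N ≃ N` through the coaction, every cotensor power of the regular bicomodule of a
coalgebra `C` is a copy of `C`, and in these coordinates the comultiplication of `T_C(C)` maps the
`n`-th copy of `C` by `Δ_C` into the tensor product of the `i`-th and the `j`-th copy, for all
`i + j = n`. On the side of power series, let `I` be an ideal of finite codimension in `A⟦X⟧`. Then
`X` is a root modulo `I` of a nonzero polynomial over `k`, which is `X ^ n * q` with `q` of nonzero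
constant term; as `q` is a unit in `A⟦X⟧`, the ideal contains `X ^ n`. So for finite-dimensional `A`
the finite dual of `A⟦X⟧` is the direct sum of copies of `A^*`, one for each coefficient, and
dualising the Cauchy product gives the same comultiplication with `C = A^*`.
-/

namespace Bicomodule

variable {k : Type u} [Field k] {C : Type v} [AddCommGroup C] [Module k C] [Coalgebra k C]

theorem lco_lid_counit_rTensor {N : Bicomodule k C} {z : C ⊗[k] N.carrier}
    (hz : z ∈ cotensorSpace (regular k C) N) :
    N.lco (TensorProduct.lid k N.carrier
      ((Coalgebra.counit (R := k) (A := C)).rTensor N.carrier z)) = z := by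
  have lid_lTensor (y : k ⊗[k] N.carrier) :
      TensorProduct.lid k _ (N.lco.lTensor k y) = N.lco (TensorProduct.lid k _ y) :=
    LinearMap.congr_fun (TensorProduct.ext'
      (g := (TensorProduct.lid k _).toLinearMap ∘ₗ N.lco.lTensor k)
      (h := N.lco ∘ₗ (TensorProduct.lid k _).toLinearMap) (fun _ _ => by simp)) y
  have lid_assoc_mk_one : (TensorProduct.lid k (C ⊗[k] N.carrier)).toLinearMap ∘ₗ
      (TensorProduct.assoc k k C N.carrier).toLinearMap ∘ₗ
        (TensorProduct.mk k k C 1).rTensor N.carrier = LinearMap.id :=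
    TensorProduct.ext' fun _ _ => by simp
  have hz' : TensorProduct.assoc k C C N.carrier
      ((Coalgebra.comul (R := k)).rTensor N.carrier z) = N.lco.lTensor C z := hz
  rw [← lid_lTensor, lTensor_rTensor_comm, ← hz', ← assoc_rTensor,
    ← LinearMap.rTensor_comp_apply, Coalgebra.rTensor_counit_comp_comul]
  exact LinearMap.congr_fun lid_assoc_mk_one z

theorem lco_injective (N : Bicomodule k C) : Function.Injective N.lco := fun m n h =>
  (TensorProduct.lid k N.carrier).symm.injective <| by
    simp only [TensorProduct.lid_symm_apply, ← N.lco_counit, h]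

/-- The unit isomorphism `N ≃ C □_C N` of the cotensor product, given by the left coaction. -/
noncomputable def lcoEquiv (N : Bicomodule k C) :
    N.carrier ≃ₗ[k] cotensorSpace (regular k C) N :=
  LinearEquiv.ofBijective (N.lco.codRestrict _ N.lco_coassoc)
    ⟨fun _ _ h => N.lco_injective (congrArg Subtype.val h),
      fun z => ⟨_, Subtype.ext (lco_lid_counit_rTensor z.2)⟩⟩

theorem subtype_comp_lcoEquiv (N : Bicomodule k C) :
    (cotensorSpace (regular k C) N).subtype ∘ₗ N.lcoEquiv.toLinearMap = N.lco := rfl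

theorem cotensorLco_lcoEquiv (N : Bicomodule k C) (n : N.carrier) :
    cotensorLco (regular k C) N (N.lcoEquiv n) =
      N.lcoEquiv.toLinearMap.lTensor C (N.lco n) := by
  apply Module.Flat.lTensor_preserves_injective_linearMap (M := C) _
    (Submodule.injective_subtype (cotensorSpace (regular k C) N))
  rw [cotensorLco_spec, ← LinearMap.lTensor_comp_apply, subtype_comp_lcoEquiv]
  exact N.lco_coassoc n

theorem cotensorMap_lcoEquiv {N N' : Bicomodule k C} {U : Type*} [AddCommGroup U] [Module k U]
    {d : N.carrier →ₗ[k] N'.carrier ⊗[k] U} (hd : IsLeftColinear d) (n : N.carrier) :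
    cotensorMap (regular k C) d hd (N.lcoEquiv n) =
      N'.lcoEquiv.toLinearMap.rTensor U (d n) := by
  apply Module.Flat.rTensor_preserves_injective_linearMap (M := U) _
    (Submodule.injective_subtype (cotensorSpace (regular k C) N'))
  rw [cotensorMap_spec, ← LinearMap.rTensor_comp_apply, subtype_comp_lcoEquiv]
  apply (TensorProduct.assoc k C N'.carrier U).injective
  exact (assoc_tensorMap (regular k C) d (N.lco n)).trans (hd n).symm

variable (k C) in
/-- The identification of `C` with the cotensor powers `C^{□ n}` of the regular bicomodule, given
by the iterated comultiplication for `n > 0`. -/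
noncomputable def regularPowEquiv : (n : ℕ) → C ≃ₗ[k] (pow (regular k C) n).carrier
  | 0 => LinearEquiv.refl k C
  | 1 => LinearEquiv.refl k C
  | n + 2 => regularPowEquiv (n + 1) ≪≫ₗ lcoEquiv (pow (regular k C) (n + 1))

theorem pow_lco_regularPowEquiv : ∀ (n : ℕ) (c : C),
    (pow (regular k C) n).lco (regularPowEquiv k C n c) =
      (regularPowEquiv k C n).toLinearMap.lTensor C (Coalgebra.comul (R := k) c)
  | 0, _ | 1, _ => (LinearMap.congr_fun (LinearMap.lTensor_id _ _) _).symm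
  | n + 2, c => (cotensorLco_lcoEquiv _ _).trans <|
    (congrArg _ (pow_lco_regularPowEquiv (n + 1) c)).trans
      (LinearMap.lTensor_comp_apply ..).symm

theorem split_regularPowEquiv : ∀ (i j : ℕ) (c : C),
    (split (regular k C) i j).1 (regularPowEquiv k C (j + i) c) =
      TensorProduct.map (regularPowEquiv k C i).toLinearMap (regularPowEquiv k C j).toLinearMap
        (Coalgebra.comul (R := k) c)
  | 0, j, c => pow_lco_regularPowEquiv j c
  | 1, 0, _ => (LinearMap.congr_fun TensorProduct.map_id _).symm
  | 1, j + 1, c => pow_lco_regularPowEquiv (j + 1) c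
  | i + 2, j, c =>
    (cotensorMap_lcoEquiv (split (regular k C) (i + 1) j).2 _).trans <|
      (congrArg _ (split_regularPowEquiv (i + 1) j c)).trans
        (LinearMap.congr_fun (LinearMap.rTensor_comp_map ..) _)

theorem splitAt_regularPowEquiv {i j n : ℕ} (h : i + j = n) (c : C) :
    splitAt (regular k C) i j n (regularPowEquiv k C n c) =
      TensorProduct.map (regularPowEquiv k C i).toLinearMap (regularPowEquiv k C j).toLinearMap
        (Coalgebra.comul (R := k) c) := by
  obtain rfl : j + i = n := by rw [add_comm, h]
  rw [splitAt_eq, split_regularPowEquiv]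

end Bicomodule

/-- A sequence of divided powers in the coalgebra `E` with coefficients in the coalgebra `C`: maps
`γₙ : C → E` with `Δ γₙ = ∑ (γᵢ ⊗ γⱼ) Δ` over all `i + j = n`, `ε γ₀ = ε`, and `ε γₙ = 0` for
`n > 0`. For `C = k` these are the usual sequences of divided powers `dₙ = γₙ 1`. -/
structure IsDividedPowerSequence {k C E : Type*} [Field k] [AddCommGroup C] [Module k C]
    [Coalgebra k C] [AddCommGroup E] [Module k E] [Coalgebra k E] (γ : ℕ → C →ₗ[k] E) : Prop where
  comul_apply : ∀ n c, Coalgebra.comul (R := k) (γ n c) =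
    ∑ p ∈ Finset.HasAntidiagonal.antidiagonal n,
      TensorProduct.map (γ p.1) (γ p.2) (Coalgebra.comul (R := k) c)
  counit_zero_apply : ∀ c, Coalgebra.counit (R := k) (γ 0 c) = Coalgebra.counit (R := k) c
  counit_succ_apply : ∀ n c, Coalgebra.counit (R := k) (γ (n + 1) c) = 0

namespace CotensorCoalgebra

open Bicomodule

variable {k : Type u} [Field k] {C : Type v} [AddCommGroup C] [Module k C] [Coalgebra k C]
  {E : Type*} [AddCommGroup E] [Module k E]

variable (k C) in
/-- The identification of `T_C(C)` with a direct sum of copies of `C`. -/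
noncomputable def directSumEquiv :
    DirectSum ℕ (fun _ => C) ≃ₗ[k] CotensorCoalgebra (regular k C) :=
  DFinsupp.mapRange.linearEquiv (regularPowEquiv k C)

theorem directSumEquiv_lof (n : ℕ) (c : C) :
    directSumEquiv k C (DirectSum.lof k ℕ (fun _ => C) n c) =
      incl _ n (regularPowEquiv k C n c) :=
  DirectSum.lmap_lof (fun n => (regularPowEquiv k C n).toLinearMap) n c

/-- The linear map `T_C(C) → E` given by `γₙ` on `C^{□ n} = C`. -/
noncomputable def regularLift (γ : ℕ → C →ₗ[k] E) : CotensorCoalgebra (regular k C) →ₗ[k] E :=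
  DirectSum.toModule k ℕ E γ ∘ₗ (directSumEquiv k C).symm.toLinearMap

theorem regularLift_incl (γ : ℕ → C →ₗ[k] E) (n : ℕ) (c : C) :
    regularLift γ (incl _ n (regularPowEquiv k C n c)) = γ n c := by
  rw [regularLift, LinearMap.comp_apply, LinearEquiv.coe_coe, ← directSumEquiv_lof,
    LinearEquiv.symm_apply_apply, DirectSum.toModule_lof]

theorem regularLift_comp_incl (γ : ℕ → C →ₗ[k] E) (n : ℕ) :
    regularLift γ ∘ₗ incl _ n ∘ₗ (regularPowEquiv k C n).toLinearMap = γ n :=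
  LinearMap.ext (regularLift_incl γ n)

theorem regular_hom_ext {f g : CotensorCoalgebra (regular k C) →ₗ[k] E}
    (h : ∀ n c, f (incl _ n (regularPowEquiv k C n c)) = g (incl _ n (regularPowEquiv k C n c))) :
    f = g :=
  hom_ext _ fun n => (regularPowEquiv k C n).surjective.forall.2 (h n)

theorem comul_incl_regularPowEquiv (n : ℕ) (c : C) :
    Coalgebra.comul (R := k) (incl (regular k C) n (regularPowEquiv k C n c)) =
      ∑ p ∈ Finset.HasAntidiagonal.antidiagonal n,
        TensorProduct.map (incl (regular k C) p.1 ∘ₗ (regularPowEquiv k C p.1).toLinearMap)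
          (incl (regular k C) p.2 ∘ₗ (regularPowEquiv k C p.2).toLinearMap)
          (Coalgebra.comul (R := k) c) := by
  rw [comul_incl]
  refine Finset.sum_congr rfl fun p hp => ?_
  rw [splitAt_regularPowEquiv (Finset.HasAntidiagonal.mem_antidiagonal.1 hp),
    TensorProduct.map_comp, LinearMap.comp_apply]

variable [Coalgebra k E]

/-- The coalgebra isomorphism `T_C(C) ≃ E` for a sequence of divided powers `γ` that exhibits `E`
as a direct sum of copies of `C`. -/
noncomputable def regularLiftEquiv {γ : ℕ → C →ₗ[k] E} (hγ : IsDividedPowerSequence γ)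
    (hbij : Function.Bijective (DirectSum.toModule k ℕ E γ)) :
    CotensorCoalgebra (regular k C) ≃ₗc[k] E :=
  CoalgEquiv.ofBijective (f :=
    ({ toLinearMap := regularLift γ
       counit_comp := regular_hom_ext fun n c => by
        rw [LinearMap.comp_apply, regularLift_incl]
        cases n with
        | zero => exact (hγ.counit_zero_apply c).trans (counit_incl_zero _ c).symm
        | succ n => rw [hγ.counit_succ_apply, counit_incl_succ]
       map_comp_comul := regular_hom_ext fun n c => by
        simp only [LinearMap.comp_apply, comul_incl_regularPowEquiv, regularLift_incl, map_sum,
          hγ.comul_apply, TensorProduct.map_map, regularLift_comp_incl] } :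
      CotensorCoalgebra (regular k C) →ₗc[k] E))
    (hbij.comp (directSumEquiv k C).symm.bijective)

end CotensorCoalgebra

section PowerSeriesFiniteDual

open PowerSeries Module

variable {k A : Type*} [Field k] [Ring A] [Algebra k A]

theorem isUnit_aeval_powerSeries_X {q : Polynomial k} (hq : q.coeff 0 ≠ 0) :
    IsUnit (Polynomial.aeval (X : A⟦X⟧) q) := by
  have constantCoeff_aeval : constantCoeff (Polynomial.aeval (X : A⟦X⟧) q) =
      algebraMap k A (q.coeff 0) := by
    rw [Polynomial.aeval_def, Polynomial.hom_eval₂, constantCoeff_X, Polynomial.eval₂_at_zero]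
    rfl
  rw [isUnit_iff_constantCoeff, constantCoeff_aeval]
  exact (IsUnit.mk0 _ hq).map (algebraMap k A)

theorem exists_powerSeries_X_pow_mem (I : Ideal A⟦X⟧)
    [FiniteDimensional k (A⟦X⟧ ⧸ I.restrictScalars k)] :
    ∃ n, (X : A⟦X⟧) ^ n ∈ I := by
  let evalMod : Polynomial k →ₗ[k] A⟦X⟧ ⧸ I.restrictScalars k :=
    (I.restrictScalars k).mkQ ∘ₗ (Polynomial.aeval (X : A⟦X⟧)).toLinearMap
  obtain ⟨p, hpI, hp⟩ : ∃ p ∈ LinearMap.ker evalMod, p ≠ 0 :=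
    Submodule.exists_mem_ne_zero_of_ne_bot fun h =>
      Polynomial.not_finite (Module.Finite.of_injective evalMod (LinearMap.ker_eq_bot.1 h))
  obtain ⟨q, hpq, hq⟩ := Polynomial.exists_eq_pow_rootMultiplicity_mul_and_not_dvd p hp 0
  rw [map_zero, sub_zero] at hpq hq
  obtain ⟨u, hu⟩ := isUnit_aeval_powerSeries_X (A := A) (mt Polynomial.X_dvd_iff.2 hq)
  have unit_mul_X_pow_mem : u * (X : A⟦X⟧) ^ p.rootMultiplicity 0 ∈ I := by
    have aeval_mem : Polynomial.aeval (X : A⟦X⟧) p ∈ I := (Submodule.Quotient.mk_eq_zero _).1 hpI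
    rwa [hpq, map_mul, map_pow, Polynomial.aeval_X, ← hu, X_pow_mul] at aeval_mem
  exact ⟨_, (I.unit_mul_mem_iff_mem u.isUnit).1 unit_mul_X_pow_mem⟩

theorem mem_span_powerSeries_X_pow_iff {n : ℕ} {p : A⟦X⟧} :
    p ∈ Ideal.span {(X : A⟦X⟧) ^ n} ↔ X ^ n ∣ p := by
  simp only [Ideal.mem_span_singleton', dvd_def, X_pow_mul, eq_comm]

theorem isTwoSided_span_powerSeries_X_pow (n : ℕ) : (Ideal.span {(X : A⟦X⟧) ^ n}).IsTwoSided :=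
  ⟨fun q hp => mem_span_powerSeries_X_pow_iff.2 ((mem_span_powerSeries_X_pow_iff.1 hp).mul_right q)⟩

theorem finiteDimensional_quotient_span_powerSeries_X_pow [FiniteDimensional k A] (n : ℕ) :
    FiniteDimensional k (A⟦X⟧ ⧸ (Ideal.span {(X : A⟦X⟧) ^ n}).restrictScalars k) := by
  let coeffs : A⟦X⟧ →ₗ[k] Fin n → A :=
    LinearMap.pi fun i => (coeff (R := A) i).restrictScalars k
  have ker_coeffs : LinearMap.ker coeffs = (Ideal.span {(X : A⟦X⟧) ^ n}).restrictScalars k := by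
    ext p
    rw [Submodule.restrictScalars_mem, mem_span_powerSeries_X_pow_iff, X_pow_dvd_iff,
      LinearMap.mem_ker, funext_iff, Fin.forall_iff]
    rfl
  rw [← ker_coeffs]
  exact Module.Finite.equiv coeffs.quotKerEquivRange.symm

theorem mem_finiteDual_powerSeries_iff [FiniteDimensional k A] {f : Dual k A⟦X⟧} :
    f ∈ finiteDual k A⟦X⟧ ↔ ∃ n, ∀ p, X ^ n ∣ p → f p = 0 := by
  constructor
  · rintro ⟨I, hI, hfin, hf⟩
    obtain ⟨n, hn⟩ := exists_powerSeries_X_pow_mem (k := k) I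
    exact ⟨n, fun _ ⟨q, hq⟩ => hf _ (hq ▸ I.mul_mem_right q hn)⟩
  · rintro ⟨n, hn⟩
    exact ⟨_, isTwoSided_span_powerSeries_X_pow n,
      finiteDimensional_quotient_span_powerSeries_X_pow n,
      fun p hp => hn p (mem_span_powerSeries_X_pow_iff.1 hp)⟩

theorem powerSeries_X_pow_dvd_sub_sum_monomial (n : ℕ) (p : A⟦X⟧) :
    X ^ n ∣ p - ∑ m ∈ Finset.range n, monomial m (coeff m p) := by
  refine X_pow_dvd_iff.2 fun m hm => ?_
  simp [coeff_monomial, hm]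

namespace FiniteDual

variable [FiniteDimensional k A]

variable (k A) in
/-- The embedding of `A^*` in `A⟦X⟧°` that sends `f` to the functional `p ↦ f (coeff n p)`. -/
noncomputable def coeffFunctional (n : ℕ) : Dual k A →ₗ[k] FiniteDual k A⟦X⟧ :=
  LinearMap.codRestrict (finiteDual k A⟦X⟧) ((coeff (R := A) n).restrictScalars k).dualMap
    fun f => mem_finiteDual_powerSeries_iff.2 ⟨n + 1, fun p hp => by
      simp [X_pow_dvd_iff.1 hp n n.lt_succ_self]⟩

theorem incl_coeffFunctional (n : ℕ) (f : Dual k A) (p : A⟦X⟧) :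
    incl k A⟦X⟧ (coeffFunctional k A n f) p = f (coeff n p) := rfl

theorem evalTwo_map_coeffFunctional (i j : ℕ) (z : Dual k A ⊗[k] Dual k A) (p q : A⟦X⟧) :
    evalTwo (incl k A⟦X⟧)
        (TensorProduct.map (coeffFunctional k A i) (coeffFunctional k A j) z) (p ⊗ₜ[k] q) =
      evalTwo (A := A) LinearMap.id z (coeff i p ⊗ₜ[k] coeff j q) := by
  induction z with
  | zero => simp only [map_zero, LinearMap.zero_apply]
  | add x y hx hy => simp only [map_add, LinearMap.add_apply, hx, hy]
  | tmul f g => rfl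

theorem isDividedPowerSequence_coeffFunctional :
    IsDividedPowerSequence (coeffFunctional k A) where
  comul_apply n f := by
    refine evalTwo_injective _ (incl_injective k A⟦X⟧)
      (TensorProduct.ext' fun p q => ?_)
    rw [finiteDualCoalgebra_isDualTo, incl_coeffFunctional, coeff_mul, map_sum, map_sum,
      LinearMap.sum_apply]
    refine Finset.sum_congr rfl fun ij _ => ?_
    rw [evalTwo_map_coeffFunctional, dualCoalgebra_isDualTo]
    rfl
  counit_zero_apply f := by
    rw [finiteDualCoalgebra_counit, incl_coeffFunctional, coeff_zero_one]
    rfl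
  counit_succ_apply n f := by
    rw [finiteDualCoalgebra_counit, incl_coeffFunctional, coeff_one, if_neg n.succ_ne_zero,
      map_zero]

theorem incl_toModule_coeffFunctional_monomial (x : DirectSum ℕ fun _ => Dual k A) (n : ℕ)
    (a : A) :
    incl k A⟦X⟧ (DirectSum.toModule k ℕ _ (coeffFunctional k A) x) (monomial n a) =
      x n a := by
  induction x using DirectSum.induction_on with
  | zero => simp only [map_zero, LinearMap.zero_apply, DirectSum.zero_apply]
  | add x y hx hy => simp only [map_add, LinearMap.add_apply, hx, hy, DirectSum.add_apply]
  | of m f =>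
    rw [← DirectSum.lof_eq_of k, DirectSum.toModule_lof, incl_coeffFunctional, coeff_monomial,
      DirectSum.lof_eq_of]
    obtain rfl | hmn := eq_or_ne m n
    · rw [if_pos rfl, DirectSum.of_eq_same]
    · rw [if_neg hmn, DirectSum.of_eq_of_ne _ _ _ hmn.symm, map_zero, LinearMap.zero_apply]

theorem toModule_coeffFunctional_bijective :
    Function.Bijective (DirectSum.toModule k ℕ _ (coeffFunctional k A)) := by
  constructor
  · intro x y hxy
    refine DFinsupp.ext fun n => LinearMap.ext fun a => ?_
    rw [← incl_toModule_coeffFunctional_monomial, hxy, incl_toModule_coeffFunctional_monomial]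
  · intro φ
    obtain ⟨N, hN⟩ := mem_finiteDual_powerSeries_iff.1 φ.2
    let component (n : ℕ) : Dual k A :=
      incl k A⟦X⟧ φ ∘ₗ (monomial (R := A) n).restrictScalars k
    refine ⟨∑ n ∈ Finset.range N, DirectSum.lof k ℕ _ n (component n), ?_⟩
    refine incl_injective k A⟦X⟧ (LinearMap.ext fun p => ?_)
    have eval_truncation := hN _ (powerSeries_X_pow_dvd_sub_sum_monomial N p)
    rw [map_sub, map_sum, sub_eq_zero] at eval_truncation
    simp only [map_sum, DirectSum.toModule_lof, LinearMap.sum_apply, incl_coeffFunctional]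
    exact eval_truncation.symm

end FiniteDual

end PowerSeriesFiniteDual

theorem twistedDual_refl (k A : Type*) [Field k] [Ring A] [Algebra k A]
    [FiniteDimensional k A] :
    twistedDual k (AlgEquiv.refl : A ≃ₐ[k] A) = Bicomodule.regular k (Module.Dual k A) := by
  have rco_eq : (AlgEquiv.refl : A ≃ₐ[k] A).toLinearMap.dualMap.lTensor (Module.Dual k A) ∘ₗ
      Coalgebra.comul = Coalgebra.comul (R := k) (A := Module.Dual k A) :=
    LinearMap.ext fun f => LinearMap.congr_fun (LinearMap.lTensor_id _ _) (Coalgebra.comul f)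
  simp only [twistedDual, Bicomodule.regular, rco_eq]

theorem mainTheorem6_general {k A : Type*} [Field k] [Ring A] [Algebra k A]
    [FiniteDimensional k A] :
    Nonempty (CotensorCoalgebra (twistedDual k (AlgEquiv.refl : A ≃ₐ[k] A)) ≃ₗc[k]
      FiniteDual k (PowerSeries A)) := by
  rw [twistedDual_refl]
  exact ⟨CotensorCoalgebra.regularLiftEquiv
    FiniteDual.isDividedPowerSequence_coeffFunctional
    FiniteDual.toModule_coeffFunctional_bijective⟩

theorem mainTheorem6 {k : Type*} [Field k] {D : Type*} [DivisionRing D] [Algebra k D]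
    [FiniteDimensional k D] :
    Nonempty (DC k (AlgEquiv.refl : D ≃ₐ[k] D) ≃ₗc[k] FiniteDual k (PowerSeries D)) :=
  mainTheorem6_general
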